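/- For a graph $G=(V,E)$, a function $f:V\to\mathbb{R}$ is $1$-Lipschitz if $|f(x)-f(y)|\le \mathrm{dist}_G(x,y)$ for all $x,y\in V$. Let $\mathcal{H}^d$ be the hypercube graph on $\{0,1\}^d$, in which two points are adjacent if they differ in exactly one coordinate, and let $r>0$. A local $(1,\frac14)$-Lipschitz filter over $\mathcal{H}^d$ for functions with range in $[0,r]$ is a randomized algorithm $\mathcal{A}(x,\rho)$ that gets a query $x\in\{0,1\}^d$, a random seed $\rho\in\{0,1\}^*$ drawn from a distribution that does not depend on the input function or on $x$, and (adaptive) lookup access to an input function $f:\{0,1\}^d\to[0,r]$, such that for every such $f$ the following holds with probability at least $\frac34$ over $\rho$: the function $g_\rho=\mathcal{A}(\cdot,\rho):\{0,1\}^d\to\mathbb{R}$ is $1$-Lipschitz, and $g_\rho=f$ if $f$ is $1$-Lipschitz. (The filter need not be distance-respecting: nothing else is required of $g_\rho$.) The lookup complexity of $\mathcal{A}$ on $f$ is the supremum of the number of lookups to $f$ made by $\mathcal{A}(x,\rho)$ over all queries $x$ and all seeds $\rho$ of positive probability. There is an absolute constant $\alpha>0$ such that for all even integers $r\ge 4$,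 all integers $d\ge 2^{16}r$, and every local $(1,\frac14)$-Lipschitz filter $\mathcal{A}$ over $\mathcal{H}^d$ for functions with range in $[0,r]$, there exists a function $f:\{0,1\}^d\to[0,r]$ on which the lookup complexity of $\mathcal{A}$ is at least $\left(\frac{d}{r}\right)^{\alpha r}$. -/

import Mathlib

/-- The `d`-dimensional hypercube graph on `{0,1}^d`: two points are adjacent if and only if they
differ in exactly one coordinate. -/
def hypercubeGraph (d : ℕ) : SimpleGraph (Fin d → Bool) where
  Adj x y := hammingDist x y = 1
  symm := ⟨fun x y h => by rw [hammingDist_comm]; exact h⟩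
  loopless := ⟨fun x h => by simp at h⟩

/-- `f` is `c`-Lipschitz with respect to the shortest-path distance of `G`. (`G.dist` takes the
value `0` on pairs in different components, where the distance is infinite and the condition is
void, so the condition is imposed on reachable pairs only.) -/
def IsGraphLipschitz {V : Type*} (G : SimpleGraph V) (c : ℝ) (f : V → ℝ) : Prop :=
  ∀ x y : V, G.Reachable x y → |f x - f y| ≤ c * (G.dist x y : ℝ)

/-- A deterministic adaptive computation with lookup access to a function `V → ℝ`: it either stops
and outputs a real number, or looks up the value at a point and continues depending on the answer.
No bound is put on the computation between lookups. -/
inductive LookupProgram (V : Type*) where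
  | output (value : ℝ) : LookupProgram V
  | lookup (point : V) (next : ℝ → LookupProgram V) : LookupProgram V

namespace LookupProgram

/-- The output of the program when lookups are answered by `f`. -/
noncomputable def eval {V : Type*} (f : V → ℝ) : LookupProgram V → ℝ
  | output v => v
  | lookup x next => eval f (next (f x))

/-- The number of lookups that the program makes when they are answered by `f`. -/
noncomputable def numLookups {V : Type*} (f : V → ℝ) : LookupProgram V → ℕ
  | output _ => 0
  | lookup x next => numLookups f (next (f x)) + 1

end LookupProgram

/-- A randomized local algorithm `𝒜(x, ρ)`: a distribution of the random seed `ρ ∈ {0,1}^*` and,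
for every query `x` and seed `ρ`, an adaptive program with lookup access to the input function.
The graph is hardcoded, so access to it is free. -/
structure LocalAlgorithm (V : Type*) where
  seed : PMF (List Bool)
  run : V → List Bool → LookupProgram V

namespace LocalAlgorithm

/-- The function `g_ρ` to which the algorithm with seed `ρ` provides query access on input `f`. -/
noncomputable def answer {V : Type*} (A : LocalAlgorithm V) (f : V → ℝ) (ρ : List Bool) : V → ℝ :=
  fun x => (A.run x ρ).eval f

/-- The lookup complexity of the algorithm on input `f`: the supremum of the number of lookups over all
queries and all seeds that occur with positive probability. -/
noncomputable def lookupComplexity {V : Type*} (A : LocalAlgorithm V) (f : V → ℝ) : ℕ∞ :=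
  ⨆ (x : V) (ρ ∈ A.seed.support), ((A.run x ρ).numLookups f : ℕ∞)

/-- `A` is a local `(c, δ)`-Lipschitz filter over `G` for input functions with values in `R`: for
every such `f`, with probability at least `1 - δ` over the seed, the function `g_ρ` is
`c`-Lipschitz, and it equals `f` if `f` is `c`-Lipschitz. There is no requirement on the values or
on the distance of `g_ρ` to `f` otherwise. -/
def IsLipschitzFilter {V : Type*} (A : LocalAlgorithm V) (G : SimpleGraph V) (c δ : ℝ)
    (R : Set ℝ) : Prop :=
  ∀ f : V → ℝ, (∀ x, f x ∈ R) →
    ENNReal.ofReal (1 - δ) ≤ A.seed.toOuterMeasure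
      {ρ | IsGraphLipschitz G c (A.answer f ρ) ∧ (IsGraphLipschitz G c f → A.answer f ρ = f)}

end LocalAlgorithm

/-!
Let `k = ⌊r / 2⌋` and let `x` and `y` be at distance `2 * k - 1`. The function with a valley at
`x` (value `0` at `x`, rising to `k` at distance `k`) and the one with a peak at `y` (value
`2 * k` at `y`, falling to `k` at distance `k`) are Lipschitz, so a filter has to reproduce them,
whereas the function with both is not Lipschitz and has to be changed at `x` or at `y`. Hence the
filter must tell it apart from one of the other two: when asked for the value at `x` on the valley
it looks up a point near `y`, or when asked for the value at `y` on the peak it looks up a point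
near `x`. This is forced for every pair on which the seed succeeds, and by averaging some seed
succeeds on a constant fraction of all pairs. In the hypercube a single lookup is near only a
`32 ^ k / d.choose k` fraction of the points at distance `2 * k - 1` from the query, so about
`d.choose k / 32 ^ k` lookups are needed. -/

open Finset MeasureTheory

namespace LookupProgram

variable {V : Type*}

/-- The points at which the program looks up its input when lookups are answered by `f`, in
order. -/
noncomputable def lookups (f : V → ℝ) : LookupProgram V → List V
  | output _ => []
  | lookup x next => x :: lookups f (next (f x))

theorem length_lookups (f : V → ℝ) (P : LookupProgram V) :
    (P.lookups f).length = P.numLookups f := by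
  induction P with
  | output v => rfl
  | lookup x next ih => simp [lookups, numLookups, ih]

theorem eval_congr {f g : V → ℝ} (P : LookupProgram V) (h : ∀ z ∈ P.lookups f, f z = g z) :
    P.eval f = P.eval g := by
  induction P with
  | output v => rfl
  | lookup x next ih =>
    have hx : f x = g x := h x (by simp [lookups])
    simp only [eval, ← hx]
    exact ih _ fun z hz => h z (by simp [lookups, hz])

end LookupProgram

section Lipschitz

variable {V : Type*} {G : SimpleGraph V} {c : ℝ} {k : ℕ} {x y z : V}

theorem IsGraphLipschitz.const_sub {f : V → ℝ} (hf : IsGraphLipschitz G c f) (a : ℝ) :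
    IsGraphLipschitz G c fun x => a - f x := by
  intro x y hxy
  rw [sub_sub_sub_cancel_left, abs_sub_comm]
  exact hf x y hxy

theorem isGraphLipschitz_dist (G : SimpleGraph V) (x : V) :
    IsGraphLipschitz G 1 fun z => (G.dist x z : ℝ) := by
  intro y z hyz
  have hxz : (G.dist x z : ℝ) ≤ G.dist x y + G.dist y z := mod_cast hyz.dist_triangle_right x
  have hxy : (G.dist x y : ℝ) ≤ G.dist x z + G.dist z y := mod_cast hyz.symm.dist_triangle_right x
  rw [G.dist_comm (u := z)] at hxy
  rw [one_mul, abs_sub_le_iff]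
  constructor <;> linarith

variable (G k x y) in
/-- The distance to `x` truncated at `k`: a Lipschitz function that dips to `0` at `x` and equals
`k` at distance at least `k` from `x`. -/
noncomputable def valley (z : V) : ℝ := min (k : ℝ) (G.dist x z)

variable (G k x y) in
/-- The `valley` turned upside down: a Lipschitz function that rises to `2 * k` at `y` and equals
`k` at distance at least `k` from `y`. -/
noncomputable def peak (z : V) : ℝ := 2 * k - valley G k y z

variable (G k x y) in
/-- The function with both the `valley` at `x` and the `peak` at `y`. If `k ≤ G.dist x y < 2 * k`,
its values `0` at `x` and `2 * k` at `y` prevent it from being Lipschitz. -/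
noncomputable def valleyPeak (z : V) : ℝ := valley G k x z + peak G k y z - k

theorem valley_nonneg : 0 ≤ valley G k x z := by unfold valley; positivity

theorem valley_le : valley G k x z ≤ k := min_le_left _ _

theorem valley_mem_Icc : valley G k x z ∈ Set.Icc 0 (2 * k : ℝ) := by
  constructor <;> linarith [valley_nonneg (G := G) (k := k) (x := x) (z := z),
    valley_le (G := G) (k := k) (x := x) (z := z)]

theorem peak_mem_Icc : peak G k y z ∈ Set.Icc 0 (2 * k : ℝ) := by
  obtain ⟨h₀, h₁⟩ := valley_mem_Icc (G := G) (k := k) (x := y) (z := z)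
  constructor <;> unfold peak <;> linarith

theorem valleyPeak_mem_Icc : valleyPeak G k x y z ∈ Set.Icc 0 (2 * k : ℝ) := by
  constructor <;> unfold valleyPeak peak <;>
    linarith [valley_nonneg (G := G) (k := k) (x := x) (z := z),
      valley_le (G := G) (k := k) (x := x) (z := z),
      valley_nonneg (G := G) (k := k) (x := y) (z := z),
      valley_le (G := G) (k := k) (x := y) (z := z)]

theorem valley_self : valley G k x x = 0 := by simp [valley]

theorem peak_self : peak G k y y = 2 * k := by simp [peak, valley_self]

theorem valley_of_le_dist (h : k ≤ G.dist x z) : valley G k x z = k := by simp [valley, h]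

theorem valleyPeak_eq_valley (h : k ≤ G.dist y z) : valleyPeak G k x y z = valley G k x z := by
  rw [valleyPeak, peak, valley_of_le_dist h]
  ring

theorem valleyPeak_eq_peak (h : k ≤ G.dist x z) : valleyPeak G k x y z = peak G k y z := by
  rw [valleyPeak, valley_of_le_dist h, add_sub_cancel_left]

theorem isGraphLipschitz_valley : IsGraphLipschitz G 1 (valley G k x) := by
  intro y z hyz
  refine (abs_min_sub_min_le_max ..).trans ?_
  rw [sub_self, abs_zero, max_eq_right (abs_nonneg _)]
  exact isGraphLipschitz_dist G x y z hyz

theorem isGraphLipschitz_peak : IsGraphLipschitz G 1 (peak G k y) :=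
  isGraphLipschitz_valley.const_sub _

variable (G c) in
/-- The requirement that a `c`-Lipschitz filter has to meet on input `f` with output `g`. -/
def IsValidOutput (f g : V → ℝ) : Prop :=
  IsGraphLipschitz G c g ∧ (IsGraphLipschitz G c f → g = f)

/-- If the programs saw no difference, then their outputs on `valleyPeak` would be `0` and `2 * k`,
which is too large a gap for a Lipschitz function. -/
theorem exists_lookup_near_of_isValidOutput (hxy : G.Reachable x y) (hlt : G.dist x y < 2 * k)
    (P : V → LookupProgram V)
    (hvalley : IsValidOutput G 1 (valley G k x) fun v => (P v).eval (valley G k x))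
    (hpeak : IsValidOutput G 1 (peak G k y) fun v => (P v).eval (peak G k y))
    (hboth : IsValidOutput G 1 (valleyPeak G k x y) fun v => (P v).eval (valleyPeak G k x y)) :
    (∃ z ∈ (P x).lookups (valley G k x), G.dist y z < k) ∨
      ∃ z ∈ (P y).lookups (peak G k y), G.dist x z < k := by
  by_contra! ⟨hfar_y, hfar_x⟩
  have hx : (P x).eval (valleyPeak G k x y) = 0 := by
    rw [← (P x).eval_congr fun z hz => (valleyPeak_eq_valley (hfar_y z hz)).symm,
      congrFun (hvalley.2 isGraphLipschitz_valley) x, valley_self]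
  have hy : (P y).eval (valleyPeak G k x y) = 2 * k := by
    rw [← (P y).eval_congr fun z hz => (valleyPeak_eq_peak (hfar_x z hz)).symm,
      congrFun (hpeak.2 isGraphLipschitz_peak) y, peak_self]
  have hgap : |(P x).eval (valleyPeak G k x y) - (P y).eval (valleyPeak G k x y)| ≤
    1 * (G.dist x y : ℝ) := hboth.1 x y hxy
  rw [hx, hy, zero_sub, abs_neg, abs_of_nonneg (by positivity), one_mul] at hgap
  exact hlt.not_ge (mod_cast hgap)

end Lipschitz

section Counting

variable {V : Type*} [Fintype V] {G : SimpleGraph V} {k m q M : ℕ}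

theorem card_filter_exists_mem_le (hM : ∀ x z, #{y | G.dist x y = m ∧ G.dist y z < k} ≤ M)
    {L : V → List V} (hL : ∀ x, (L x).length ≤ q) :
    #{p : V × V | G.dist p.1 p.2 = m ∧ ∃ z ∈ L p.1, G.dist p.2 z < k} ≤
      Fintype.card V * (q * M) := by
  classical
  have hfiber (x : V) : #{y | G.dist x y = m ∧ ∃ z ∈ L x, G.dist y z < k} ≤ q * M :=
    calc #{y | G.dist x y = m ∧ ∃ z ∈ L x, G.dist y z < k}
      _ ≤ #((L x).toFinset.biUnion fun z => {y | G.dist x y = m ∧ G.dist y z < k}) := by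
        refine card_le_card fun y => ?_
        simp only [mem_filter_univ, mem_biUnion, List.mem_toFinset]
        exact fun ⟨hxy, z, hz, hyz⟩ => ⟨z, hz, hxy, hyz⟩
      _ ≤ #(L x).toFinset * M := card_biUnion_le_card_mul _ _ _ fun z _ => hM x z
      _ ≤ q * M := Nat.mul_le_mul_right _ ((List.toFinset_card_le _).trans (hL x))
  calc #{p : V × V | G.dist p.1 p.2 = m ∧ ∃ z ∈ L p.1, G.dist p.2 z < k}
    _ = ∑ x, #{y | G.dist x y = m ∧ ∃ z ∈ L x, G.dist y z < k} := by
      simp only [card_filter, Fintype.sum_prod_type]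
    _ ≤ Fintype.card V * (q * M) := sum_le_card_nsmul _ _ _ fun x _ => hfiber x

theorem card_le_of_isValidOutput (hG : G.Preconnected) (hm : m < 2 * k)
    (hM : ∀ x z, #{y | G.dist x y = m ∧ G.dist y z < k} ≤ M) {P : V → LookupProgram V}
    (hvalley : ∀ x, (P x).numLookups (valley G k x) ≤ q)
    (hpeak : ∀ y, (P y).numLookups (peak G k y) ≤ q) {s : Finset (V × V)}
    (hdist : ∀ p ∈ s, G.dist p.1 p.2 = m)
    (hvalid : ∀ p ∈ s,
      IsValidOutput G 1 (valley G k p.1) (fun v => (P v).eval (valley G k p.1)) ∧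
      IsValidOutput G 1 (peak G k p.2) (fun v => (P v).eval (peak G k p.2)) ∧
      IsValidOutput G 1 (valleyPeak G k p.1 p.2)
        (fun v => (P v).eval (valleyPeak G k p.1 p.2))) :
    #s ≤ 2 * (Fintype.card V * (q * M)) := by
  classical
  set nearPeak : Finset (V × V) :=
    {p | G.dist p.1 p.2 = m ∧ ∃ z ∈ (P p.1).lookups (valley G k p.1), G.dist p.2 z < k}
  set nearValley : Finset (V × V) :=
    {p | G.dist p.1 p.2 = m ∧ ∃ z ∈ (P p.1).lookups (peak G k p.1), G.dist p.2 z < k}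
  have hnearPeak : #nearPeak ≤ Fintype.card V * (q * M) :=
    card_filter_exists_mem_le hM fun x => (LookupProgram.length_lookups ..).trans_le (hvalley x)
  have hnearValley : #nearValley ≤ Fintype.card V * (q * M) :=
    card_filter_exists_mem_le hM fun y => (LookupProgram.length_lookups ..).trans_le (hpeak y)
  have hsub : s ⊆ nearPeak ∪ nearValley.image Prod.swap := by
    rintro ⟨x, y⟩ hp
    obtain ⟨hvalley, hpeak, hboth⟩ := hvalid _ hp
    have hxy : G.dist x y = m := hdist _ hp
    obtain hz | hz := exists_lookup_near_of_isValidOutput (hG x y) (hxy.trans_lt hm) P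
      hvalley hpeak hboth
    · exact mem_union_left _ ((mem_filter_univ _).2 ⟨hxy, hz⟩)
    · exact mem_union_right _ (mem_image.2
        ⟨(y, x), (mem_filter_univ _).2 ⟨G.dist_comm.trans hxy, hz⟩, rfl⟩)
  calc #s ≤ #(nearPeak ∪ nearValley.image Prod.swap) := card_le_card hsub
    _ ≤ #nearPeak + #nearValley := (card_union_le ..).trans (add_le_add_right card_image_le _)
    _ ≤ 2 * (Fintype.card V * (q * M)) := by linarith

end Counting

section Probability

variable {α ι : Type*} (p : PMF α)

theorem ofReal_one_sub_add_le_toOuterMeasure_inter {s t : Set α} {a b : ℝ}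
    (hs : ENNReal.ofReal (1 - a) ≤ p.toOuterMeasure s)
    (ht : ENNReal.ofReal (1 - b) ≤ p.toOuterMeasure t) :
    ENNReal.ofReal (1 - (a + b)) ≤ p.toOuterMeasure (s ∩ t) := by
  let _ : MeasurableSpace α := ⊤
  simp only [← p.toMeasure_apply_eq_toOuterMeasure,
    ENNReal.ofReal_le_iff_le_toReal (measure_ne_top _ _), ← measureReal_def] at hs ht ⊢
  have hadd := measureReal_union_add_inter (μ := p.toMeasure) (s := s) (t := t)
    MeasurableSpace.measurableSet_top
  have hunion := measureReal_le_one (μ := p.toMeasure) (s := s ∪ t)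
  linarith

theorem exists_mem_support_mul_card_le (s : Finset ι) {E : ι → Set α}
    [∀ a, DecidablePred (a ∈ E ·)] {c : ℝ}
    (hE : ∀ i ∈ s, ENNReal.ofReal c ≤ p.toOuterMeasure (E i)) :
    ∃ a ∈ p.support, c * #s ≤ #{i ∈ s | a ∈ E i} := by
  let _ : MeasurableSpace α := ⊤
  have hcount : ∫⁻ a, #{i ∈ s | a ∈ E i} ∂p.toMeasure = ∑ i ∈ s, p.toOuterMeasure (E i) := by
    simp_rw [← p.toMeasure_apply_eq_toOuterMeasure,
      ← lintegral_indicator_one (μ := p.toMeasure) (MeasurableSpace.measurableSet_top),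
      ← lintegral_finsetSum s fun _ _ => measurable_from_top]
    simp [Set.indicator_apply]
  have hnull : p.toMeasure p.supportᶜ = 0 := by
    rw [p.toMeasure_apply_eq_zero_iff MeasurableSpace.measurableSet_top]
    exact disjoint_compl_right
  obtain ⟨a, ha, hle⟩ := exists_notMem_null_lintegral_le (μ := p.toMeasure)
    (f := fun a => (#{i ∈ s | a ∈ E i} : ENNReal)) (by
      rw [hcount, ENNReal.sum_ne_top]
      simp_rw [← p.toMeasure_apply_eq_toOuterMeasure]
      exact fun _ _ => measure_ne_top _ _) hnull
  refine ⟨a, not_not.1 ha, ?_⟩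
  rw [← ENNReal.ofReal_le_ofReal_iff (Nat.cast_nonneg _), ENNReal.ofReal_mul' (Nat.cast_nonneg _),
    ENNReal.ofReal_natCast, ENNReal.ofReal_natCast, mul_comm, ← nsmul_eq_mul]
  exact (card_nsmul_le_sum _ _ _ hE).trans (hcount ▸ hle)

end Probability

section Filter

variable {V : Type*} {G : SimpleGraph V} {A : LocalAlgorithm V} {c δ : ℝ}

namespace LocalAlgorithm

theorem IsLipschitzFilter.mono {R S : Set ℝ} (hA : A.IsLipschitzFilter G c δ R) (hS : S ⊆ R) :
    A.IsLipschitzFilter G c δ S :=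
  fun f hf => hA f fun x => hS (hf x)

theorem numLookups_le_lookupComplexity (f : V → ℝ) (x : V) {ρ : List Bool}
    (hρ : ρ ∈ A.seed.support) : ((A.run x ρ).numLookups f : ℕ∞) ≤ A.lookupComplexity f :=
  le_iSup_of_le x (le_iSup₂_of_le ρ hρ le_rfl)

/-- A pair `(x, y)` is good for a seed if the output is valid on its valley, peak and valley with
peak. Every pair is good with probability at least `1 - 3 * δ`, so some seed is good for at least
that fraction of the pairs. -/
theorem IsLipschitzFilter.mul_card_le [Fintype V] {k m q M : ℕ}
    (hA : A.IsLipschitzFilter G 1 δ (Set.Icc 0 (2 * k))) (hG : G.Preconnected) (hm : m < 2 * k)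
    (hM : ∀ x z, #{y | G.dist x y = m ∧ G.dist y z < k} ≤ M)
    (hq : ∀ f : V → ℝ, (∀ x, f x ∈ Set.Icc 0 (2 * k : ℝ)) → A.lookupComplexity f ≤ q) :
    (1 - 3 * δ) * #{p : V × V | G.dist p.1 p.2 = m} ≤ 2 * (Fintype.card V * (q * M)) := by
  classical
  let valid (f : V → ℝ) : Set (List Bool) := {ρ | IsValidOutput G 1 f (A.answer f ρ)}
  have hvalid (p : V × V) : ENNReal.ofReal (1 - 3 * δ) ≤ A.seed.toOuterMeasure
      (valid (valley G k p.1) ∩ (valid (peak G k p.2) ∩ valid (valleyPeak G k p.1 p.2))) := by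
    rw [show 3 * δ = δ + (δ + δ) by ring]
    exact ofReal_one_sub_add_le_toOuterMeasure_inter _ (hA _ fun _ => valley_mem_Icc)
      (ofReal_one_sub_add_le_toOuterMeasure_inter _ (hA _ fun _ => peak_mem_Icc)
        (hA _ fun _ => valleyPeak_mem_Icc))
  obtain ⟨ρ, hρ, hcard⟩ := exists_mem_support_mul_card_le A.seed
    {p : V × V | G.dist p.1 p.2 = m} fun p _ => hvalid p
  have hlookups {f : V → ℝ} (hf : ∀ x, f x ∈ Set.Icc 0 (2 * k : ℝ)) (x : V) :
      (A.run x ρ).numLookups f ≤ q :=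
    Nat.cast_le.1 ((numLookups_le_lookupComplexity f x hρ).trans (hq f hf))
  refine hcard.trans (mod_cast card_le_of_isValidOutput hG hm hM (P := fun x => A.run x ρ)
    (fun x => hlookups (fun _ => valley_mem_Icc) x) (fun y => hlookups (fun _ => peak_mem_Icc) y)
    (fun p hp => (mem_filter_univ p).1 (mem_filter.1 hp).1) fun p hp => (mem_filter.1 hp).2)

end LocalAlgorithm

end Filter

section Hamming

variable {ι : Type*} [Fintype ι] {β : ι → Type*} [∀ i, DecidableEq (β i)] [DecidableEq ι]

theorem hammingDist_update_of_ne {x : ∀ i, β i} {i : ι} {a : β i} (h : x i ≠ a) :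
    hammingDist x (Function.update x i a) = 1 := by
  rw [hammingDist, card_eq_one]
  refine ⟨i, ext fun j => ?_⟩
  obtain rfl | hj := eq_or_ne j i <;> simp [*]

theorem hammingDist_update_add_one {x y : ∀ i, β i} {i : ι} (h : x i ≠ y i) :
    hammingDist (Function.update x i (y i)) y + 1 = hammingDist x y := by
  have herase : ({j | Function.update x i (y i) j ≠ y j} : Finset ι) =
      ({j | x j ≠ y j} : Finset ι).erase i := by
    ext j
    obtain rfl | hj := eq_or_ne j i <;> simp [*]
  rw [hammingDist, hammingDist, herase, card_erase_add_one (by simpa using h)]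

/-- Points of the cube as sets of coordinates: `y` corresponds to the set of coordinates where it
differs from a fixed base point `x`, so that `hammingDist x y` becomes the cardinality. -/
def diffEquiv (x : ι → Bool) : (ι → Bool) ≃ Finset ι where
  toFun y := {i | x i ≠ y i}
  invFun T i := x i ^^ decide (i ∈ T)
  left_inv y := by ext i; cases hx : x i <;> cases hy : y i <;> simp [hx, hy]
  right_inv T := by ext i; cases hx : x i <;> simp [hx]

theorem mem_diffEquiv {x y : ι → Bool} {i : ι} : i ∈ diffEquiv x y ↔ x i ≠ y i := by
  simp [diffEquiv]

theorem card_diffEquiv (x y : ι → Bool) : #(diffEquiv x y) = hammingDist x y := rfl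

theorem card_hammingDist_eq (x : ι → Bool) (m : ℕ) :
    #{y | hammingDist x y = m} = (Fintype.card ι).choose m := by
  rw [card_equiv (diffEquiv x) (t := powersetCard m univ) (by simp [card_diffEquiv]),
    card_powersetCard, card_univ]

theorem card_diffEquiv_sdiff_le (x y z : ι → Bool) :
    #(diffEquiv x y \ diffEquiv x z) ≤ hammingDist y z := by
  rw [hammingDist]
  refine card_le_card fun i hi => ?_
  simp only [mem_sdiff, mem_diffEquiv, not_not] at hi
  simpa [← hi.2] using hi.1.symm

theorem card_powersetCard_filter_le_card_inter_le (S : Finset ι) (a b : ℕ) :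
    #{T ∈ powersetCard (a + b) univ | a ≤ #(T ∩ S)} ≤
      (#S).choose a * (Fintype.card ι - a).choose b := by
  have hsub : {T ∈ powersetCard (a + b) (univ : Finset ι) | a ≤ #(T ∩ S)} ⊆
      (powersetCard a S).biUnion fun U => {T ∈ powersetCard (a + b) univ | U ⊆ T} := by
    intro T hT
    obtain ⟨hcard, hinter⟩ := mem_filter.1 hT
    obtain ⟨U, hU, rfl⟩ := exists_subset_card_eq hinter
    rw [subset_inter_iff] at hU
    exact mem_biUnion.2 ⟨U, mem_powersetCard.2 ⟨hU.2, rfl⟩, mem_filter.2 ⟨hcard, hU.1⟩⟩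
  rw [← card_powersetCard a S]
  refine (card_le_card hsub).trans (card_biUnion_le_card_mul _ _ _ fun U hU => ?_)
  obtain ⟨-, rfl⟩ := mem_powersetCard.1 hU
  rw [card_filter_powersetCard_subset _ _ _ (subset_univ U) (Nat.le_add_right ..), card_univ,
    Nat.add_sub_cancel_left]

/-- A point `z` close to such a `y` is close to `x`, so `diffEquiv x z` is small, and it contains
`k` of the `2 * k - 1` elements of `diffEquiv x y`. -/
theorem card_hammingDist_eq_and_lt_le {k : ℕ} (hk : 1 ≤ k) (x z : ι → Bool) :
    #{y | hammingDist x y = 2 * k - 1 ∧ hammingDist y z < k} ≤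
      2 ^ (3 * k) * (Fintype.card ι - k).choose (k - 1) := by
  set F : Finset (ι → Bool) := {y | hammingDist x y = 2 * k - 1 ∧ hammingDist y z < k}
  obtain hF | ⟨y₀, hy₀⟩ := F.eq_empty_or_nonempty
  · simp [hF]
  have hxz : #(diffEquiv x z) ≤ 3 * k := by
    obtain ⟨hxy₀, hy₀z⟩ := (mem_filter_univ _).1 hy₀
    have := hammingDist_triangle x y₀ z
    rw [card_diffEquiv]
    omega
  have hmaps : ∀ y ∈ F, diffEquiv x y ∈
      ({T ∈ powersetCard (k + (k - 1)) univ | k ≤ #(T ∩ diffEquiv x z)} : Finset (Finset ι)) := by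
    intro y hy
    obtain ⟨hxy, hyz⟩ := (mem_filter_univ _).1 hy
    have hsdiff := card_diffEquiv_sdiff_le x y z
    have hsplit := card_sdiff_add_card_inter (diffEquiv x y) (diffEquiv x z)
    rw [card_diffEquiv x y] at hsplit
    rw [mem_filter, mem_powersetCard_univ, card_diffEquiv x y]
    omega
  calc #F
    _ ≤ #{T ∈ powersetCard (k + (k - 1)) univ | k ≤ #(T ∩ diffEquiv x z)} :=
      card_le_card_of_injOn _ hmaps (diffEquiv x).injective.injOn
    _ ≤ (#(diffEquiv x z)).choose k * (Fintype.card ι - k).choose (k - 1) :=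
      card_powersetCard_filter_le_card_inter_le ..
    _ ≤ 2 ^ (3 * k) * (Fintype.card ι - k).choose (k - 1) := by
      gcongr
      exact (Nat.choose_le_two_pow ..).trans (Nat.pow_le_pow_right two_pos hxz)

end Hamming

section Hypercube

variable {d : ℕ}

theorem hammingDist_le_walk_length {x y : Fin d → Bool} (w : (hypercubeGraph d).Walk x y) :
    hammingDist x y ≤ w.length := by
  induction w with
  | nil => simp
  | @cons x x' y hadj w ih =>
    calc hammingDist x y ≤ hammingDist x x' + hammingDist x' y := hammingDist_triangle ..
      _ ≤ 1 + w.length := add_le_add (le_of_eq hadj) ih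
      _ = (w.cons hadj).length := by rw [SimpleGraph.Walk.length_cons, add_comm]

theorem exists_walk_length_eq_hammingDist (x y : Fin d → Bool) :
    ∃ w : (hypercubeGraph d).Walk x y, w.length = hammingDist x y := by
  induction hn : hammingDist x y generalizing x with
  | zero =>
    obtain rfl := hammingDist_eq_zero.1 hn
    exact ⟨.nil, rfl⟩
  | succ n ih =>
    obtain ⟨i, hi⟩ := Function.ne_iff.1 (hammingDist_pos.1 (n.succ_pos.trans_eq hn.symm))
    have hadj : (hypercubeGraph d).Adj x (Function.update x i (y i)) := hammingDist_update_of_ne hi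
    obtain ⟨w, hw⟩ := ih _ (Nat.succ_injective ((hammingDist_update_add_one hi).trans hn))
    exact ⟨w.cons hadj, congrArg (· + 1) hw⟩

theorem hypercubeGraph_preconnected (d : ℕ) : (hypercubeGraph d).Preconnected :=
  fun x y => (exists_walk_length_eq_hammingDist x y).choose.reachable

theorem hypercubeGraph_dist (x y : Fin d → Bool) :
    (hypercubeGraph d).dist x y = hammingDist x y := by
  obtain ⟨w, hw⟩ := exists_walk_length_eq_hammingDist x y
  obtain ⟨w', hw'⟩ := w.reachable.exists_walk_length_eq_dist
  exact le_antisymm (hw ▸ SimpleGraph.dist_le w) (hw' ▸ hammingDist_le_walk_length w')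

theorem card_hypercubeGraph_dist_eq (d m : ℕ) :
    #{p : (Fin d → Bool) × (Fin d → Bool) | (hypercubeGraph d).dist p.1 p.2 = m} =
      2 ^ d * d.choose m := by
  simp_rw [hypercubeGraph_dist, card_filter, Fintype.sum_prod_type, ← card_filter,
    card_hammingDist_eq]
  simp

end Hypercube

section Estimates

theorem choose_mul_choose_sub_one_le {d k : ℕ} (hk : 1 ≤ k) :
    d.choose k * (d - k).choose (k - 1) ≤ d.choose (2 * k - 1) * 4 ^ k := by
  have hmul := Nat.choose_mul (n := d) (k := 2 * k - 1) (s := k) (by omega)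
  rw [show 2 * k - 1 - k = k - 1 by omega] at hmul
  rw [← hmul]
  gcongr
  calc (2 * k - 1).choose k ≤ 2 ^ (2 * k - 1) := Nat.choose_le_two_pow ..
    _ ≤ 2 ^ (2 * k) := Nat.pow_le_pow_right two_pos (Nat.sub_le ..)
    _ = 4 ^ k := by rw [pow_mul]; norm_num

theorem div_two_mul_pow_le_choose {d k : ℕ} (hd : 2 * k ≤ d) :
    ((d : ℝ) / (2 * k)) ^ k ≤ d.choose k := by
  have hhalf : (d : ℝ) / 2 ≤ (d + 1 - k : ℕ) := by
    rw [div_le_iff₀ two_pos]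
    exact_mod_cast (by omega : d ≤ (d + 1 - k) * 2)
  calc ((d : ℝ) / (2 * k)) ^ k = (d / 2) ^ k / k ^ k := by rw [← div_div, div_pow]
    _ ≤ (d + 1 - k : ℕ) ^ k / k.factorial := by
      gcongr
      exact_mod_cast k.factorial_le_pow
    _ ≤ d.choose k := Nat.pow_le_choose k d

/-- The constant `2 ^ 16` makes `t / 256 ≥ √t` for `t = d / (2 * k)`. -/
theorem rpow_half_le_of_choose_le {d k q : ℕ} (hk : 1 ≤ k) (hd : 2 ^ 16 * (2 * k) ≤ d)
    (hq : d.choose k ≤ 8 * 32 ^ k * q) : ((d : ℝ) / (2 * k)) ^ (k / 2 : ℝ) ≤ q := by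
  set t : ℝ := d / (2 * k) with ht
  have ht0 : 0 ≤ t := by positivity
  have hsqrt : 256 ≤ √t := by
    refine Real.le_sqrt_of_sq_le ?_
    rw [ht, le_div_iff₀ (by positivity)]
    exact_mod_cast (show 256 ^ 2 * (2 * k) ≤ d by omega)
  have hconst : (8 * 32 ^ k : ℝ) ≤ 256 ^ k :=
    calc (8 * 32 ^ k : ℝ) ≤ 8 ^ k * 32 ^ k := by gcongr; exact le_self_pow₀ (by norm_num) (by omega)
      _ = 256 ^ k := by rw [← mul_pow]; norm_num
  rw [Real.rpow_div_two_eq_sqrt _ ht0, Real.rpow_natCast]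
  refine le_of_mul_le_mul_left ?_ (show (0 : ℝ) < 256 ^ k by positivity)
  calc 256 ^ k * √t ^ k ≤ √t ^ k * √t ^ k := by gcongr
    _ = t ^ k := by rw [← mul_pow, Real.mul_self_sqrt ht0]
    _ ≤ d.choose k := div_two_mul_pow_le_choose (by omega)
    _ ≤ 8 * 32 ^ k * q := mod_cast hq
    _ ≤ 256 ^ k * q := by gcongr

end Estimates

section LowerBound

variable {d k : ℕ} {A : LocalAlgorithm (Fin d → Bool)}

namespace LocalAlgorithm

theorem IsLipschitzFilter.mul_choose_le {δ : ℝ} {q : ℕ} (hk : 1 ≤ k) (hd : 2 * k ≤ d)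
    (hA : A.IsLipschitzFilter (hypercubeGraph d) 1 δ (Set.Icc 0 (2 * k)))
    (hq : ∀ f, (∀ x, f x ∈ Set.Icc 0 (2 * k : ℝ)) → A.lookupComplexity f ≤ q) :
    (1 - 3 * δ) * d.choose k ≤ 2 * 32 ^ k * q := by
  obtain hδ | hδ := le_total (1 - 3 * δ) 0
  · exact (mul_nonpos_of_nonpos_of_nonneg hδ (Nat.cast_nonneg _)).trans (by positivity)
  have hpairs := hA.mul_card_le (hypercubeGraph_preconnected d) (m := 2 * k - 1) (by omega)
    (by simpa only [hypercubeGraph_dist, Fintype.card_fin] using card_hammingDist_eq_and_lt_le hk)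
    hq
  rw [card_hypercubeGraph_dist_eq, Fintype.card_fun, Fintype.card_bool, Fintype.card_fin]
    at hpairs
  push_cast at hpairs
  set D := (d - k).choose (k - 1)
  have hD : (0 : ℝ) < D := Nat.cast_pos.2 (Nat.choose_pos (by omega))
  have hsphere : (1 - 3 * δ) * d.choose (2 * k - 1) ≤ 2 * 8 ^ k * q * D := by
    refine le_of_mul_le_mul_left ?_ (show (0 : ℝ) < 2 ^ d by positivity)
    rw [pow_mul, show (2 : ℝ) ^ 3 = 8 by norm_num] at hpairs
    linarith
  refine le_of_mul_le_mul_right ?_ hD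
  calc (1 - 3 * δ) * d.choose k * D = (1 - 3 * δ) * (d.choose k * D) := mul_assoc ..
    _ ≤ (1 - 3 * δ) * (d.choose (2 * k - 1) * 4 ^ k) := by
      refine mul_le_mul_of_nonneg_left ?_ hδ
      exact_mod_cast choose_mul_choose_sub_one_le hk
    _ = (1 - 3 * δ) * d.choose (2 * k - 1) * 4 ^ k := (mul_assoc ..).symm
    _ ≤ 2 * 8 ^ k * q * D * 4 ^ k := by gcongr
    _ = 2 * 32 ^ k * q * D := by rw [show (32 : ℝ) = 8 * 4 by norm_num, mul_pow]; ring

theorem IsLipschitzFilter.exists_rpow_half_le_lookupComplexity (hk : 1 ≤ k)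
    (hd : 2 ^ 16 * (2 * k) ≤ d)
    (hA : A.IsLipschitzFilter (hypercubeGraph d) 1 (1 / 4) (Set.Icc 0 (2 * k))) :
    ∃ f : (Fin d → Bool) → ℝ, (∀ x, f x ∈ Set.Icc 0 (2 * k : ℝ)) ∧
      ENNReal.ofReal (((d : ℝ) / (2 * k)) ^ (k / 2 : ℝ)) ≤
        ((A.lookupComplexity f : ℕ∞) : ENNReal) := by
  by_contra! hlt
  set Q : ℝ := ((d : ℝ) / (2 * k)) ^ (k / 2 : ℝ)
  have hd_pos : 0 < d := by omega
  obtain ⟨q, hq⟩ := Nat.exists_eq_add_one.2 (Nat.ceil_pos.2 (show 0 < Q by positivity))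
  have hlookup (f : (Fin d → Bool) → ℝ) (hf : ∀ x, f x ∈ Set.Icc 0 (2 * k : ℝ)) :
      A.lookupComplexity f ≤ q := by
    have hceil := (hlt f hf).trans_le (ENNReal.ofReal_le_ofReal (Nat.le_ceil Q))
    rw [hq, ENNReal.ofReal_natCast, ← ENat.toENNReal_coe, ENat.toENNReal_lt] at hceil
    exact Order.le_of_lt_add_one hceil
  have hchoose := hA.mul_choose_le hk (by omega) hlookup
  have hQq : Q ≤ q := by
    refine rpow_half_le_of_choose_le hk hd ?_
    rw [← Nat.cast_le (α := ℝ)]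
    push_cast
    linarith
  exact hQq.not_gt (Nat.lt_ceil.1 (hq ▸ q.lt_succ_self))

end LocalAlgorithm

end LowerBound

theorem mainTheorem3_general :
    ∃ α : ℝ, 0 < α ∧
      ∀ (d : ℕ) (r : ℝ), 2 ≤ r → 2 ^ 16 * r ≤ d →
        ∀ A : LocalAlgorithm (Fin d → Bool),
          A.IsLipschitzFilter (hypercubeGraph d) 1 (1 / 4) (Set.Icc 0 r) →
          ∃ f : (Fin d → Bool) → ℝ, (∀ x, f x ∈ Set.Icc 0 r) ∧
            ENNReal.ofReal (((d : ℝ) / r) ^ (α * r)) ≤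
              ((A.lookupComplexity f : ℕ∞) : ENNReal) := by
  refine ⟨1 / 8, by norm_num, fun d r hr hd A hA => ?_⟩
  set k : ℕ := ⌊r / 2⌋₊
  have hk : 1 ≤ k := Nat.one_le_floor_iff _ |>.2 (by linarith)
  have hk' : (1 : ℝ) ≤ k := mod_cast hk
  have hkr : 2 * (k : ℝ) ≤ r := by linarith [Nat.floor_le (show 0 ≤ r / 2 by linarith)]
  have hrk : r ≤ 4 * k := by linarith [Nat.lt_floor_add_one (r / 2)]
  have hrange : Set.Icc 0 (2 * k : ℝ) ⊆ Set.Icc 0 r := Set.Icc_subset_Icc_right hkr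
  have hdk : 2 ^ 16 * (2 * k) ≤ d := by
    rw [← Nat.cast_le (α := ℝ)]
    push_cast
    linarith
  obtain ⟨f, hf, hle⟩ := (hA.mono hrange).exists_rpow_half_le_lookupComplexity hk hdk
  refine ⟨f, fun x => hrange (hf x), le_trans (ENNReal.ofReal_le_ofReal ?_) hle⟩
  calc ((d : ℝ) / r) ^ (1 / 8 * r) ≤ (d / r) ^ (k / 2 : ℝ) :=
        Real.rpow_le_rpow_of_exponent_le ((one_le_div (by linarith)).2 (by linarith))
          (by linarith)
    _ ≤ (d / (2 * k)) ^ (k / 2 : ℝ) := by gcongr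

theorem mainTheorem3 :
    ∃ α : ℝ, 0 < α ∧
      ∀ (d r : ℕ), Even r → 4 ≤ r → 2 ^ 16 * r ≤ d →
        ∀ A : LocalAlgorithm (Fin d → Bool),
          A.IsLipschitzFilter (hypercubeGraph d) 1 (1 / 4) (Set.Icc 0 (r : ℝ)) →
          ∃ f : (Fin d → Bool) → ℝ, (∀ x, f x ∈ Set.Icc 0 (r : ℝ)) ∧
            ENNReal.ofReal (((d : ℝ) / (r : ℝ)) ^ (α * (r : ℝ))) ≤
              ((A.lookupComplexity f : ℕ∞) : ENNReal) := by
  obtain ⟨α, hα, hbound⟩ := mainTheorem3_general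
  exact ⟨α, hα, fun d r _ hr hd => hbound d r (mod_cast show 2 ≤ r by omega) (mod_cast hd)⟩
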